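/- For a lattice polytope $\mathcal P\subset\mathbb R^N$ of dimension $d$, its $\delta$-vector $(\delta_0,\dots,\delta_d)$ is the integer sequence defined by $$(1-t)^{d+1}\Bigl(1+\sum_{n\ge 1}|n\mathcal P\cap\mathbb Z^N|\,t^n\Bigr)=\sum_{i=0}^d\delta_i t^i .$$ It is unimodal if $\delta_0\le\dots\le\delta_c\ge\delta_{c+1}\ge\dots\ge\delta_d$ for some $0\le c\le d$. For all integers $d\ge 5$ and $m\ge 1$ there is a lattice simplex in $\mathbb R^d$ of dimension $d$ which has exactly $m$ lattice points in its interior and whose $\delta$-vector is not unimodal. Explicitly, let $\ell\ge 2$ and $m\ge 1$ be integers, and let $\mathbf e_1,\dots,\mathbf e_d$ be the unit coordinate vectors of $\mathbb R^d$. (Odd dimension.) Let $d=2\ell+1$ and $M=2(2m+1)(\ell+1)$, and let $\mathcal P_{\mathrm{odd}}(\ell,m)$ be the convex hull of $\mathbf 0,\mathbf e_1,\dots,\mathbf e_{d-1}$ and $$(M-2(\ell+1)m)\,\mathbf e_1+(M-1)(\mathbf e_2+\dots+\mathbf e_{d-1})+M\,\mathbf e_d .$$ (Even dimension.) Let $d=2\ell+2$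 and $M=2(3m+1)(\ell+1)$, and let $\mathcal P_{\mathrm{even}}(\ell,m)$ be the convex hull of $\mathbf 0,\mathbf e_1,\dots,\mathbf e_{d-1}$ and $$(M-2(\ell+1)m)(\mathbf e_1+\mathbf e_2)+(M-1)(\mathbf e_3+\dots+\mathbf e_{d-1})+M\,\mathbf e_d .$$ Each of these polytopes is a $d$-dimensional lattice simplex with exactly $m$ interior lattice points, and its $\delta$-vector satisfies $$\delta_1<\delta_\ell>\delta_{\ell+1}<\max\{\delta_{\ell+2},\dots,\delta_{2\ell}\};$$ in particular it is not unimodal. -/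

import Mathlib

open scoped Pointwise

/-- The inclusion of the lattice `ℤ^N` into `ℝ^N`. -/
def latticeEmb {N : ℕ} (x : Fin N → ℤ) : Fin N → ℝ := fun k => (x k : ℝ)

/-- `P ⊆ ℝ^N` is a lattice simplex of dimension `d`: the convex hull of `d + 1` affinely
independent lattice points. -/
def IsLatticeSimplex {N : ℕ} (d : ℕ) (P : Set (Fin N → ℝ)) : Prop :=
  ∃ v : Fin (d + 1) → Fin N → ℤ,
    AffineIndependent ℝ (fun i => latticeEmb (v i)) ∧
      P = convexHull ℝ (Set.range fun i => latticeEmb (v i))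

/-- The dimension of `P`, i.e. the dimension of its affine hull. -/
noncomputable def polytopeDim {N : ℕ} (P : Set (Fin N → ℝ)) : ℕ :=
  Module.finrank ℝ (vectorSpan ℝ P)

/-- The set `S ∩ ℤ^N`. -/
def latticePoints {N : ℕ} (S : Set (Fin N → ℝ)) : Set (Fin N → ℤ) :=
  {x | latticeEmb x ∈ S}

/-- The Ehrhart counting function `i(P, n) = |nP ∩ ℤ^N|`. -/
noncomputable def ehrhartCount {N : ℕ} (P : Set (Fin N → ℝ)) (n : ℕ) : ℕ :=
  (latticePoints ((n : ℝ) • P)).ncard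

/-- The Ehrhart series `1 + ∑_{n ≥ 1} i(P, n) t^n`. -/
noncomputable def ehrhartSeries {N : ℕ} (P : Set (Fin N → ℝ)) : PowerSeries ℤ :=
  PowerSeries.mk fun n => if n = 0 then 1 else (ehrhartCount P n : ℤ)

/-- The power series `(1 - t)^(d+1) (1 + ∑_{n ≥ 1} i(P, n) t^n)`, where `d = dim P`. -/
noncomputable def deltaSeries {N : ℕ} (P : Set (Fin N → ℝ)) : PowerSeries ℤ :=
  (1 - PowerSeries.X) ^ (polytopeDim P + 1) * ehrhartSeries P

/-- The entry `δ_i` of the `δ`-vector `(δ_0, …, δ_d)` of `P`, `d = dim P`. -/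
noncomputable def delta {N : ℕ} (P : Set (Fin N → ℝ)) (i : ℕ) : ℤ :=
  PowerSeries.coeff i (deltaSeries P)

/-- The number of lattice points in the (relative) interior of `P`. -/
noncomputable def interiorLatticeCount {N : ℕ} (P : Set (Fin N → ℝ)) : ℕ :=
  (latticePoints (intrinsicInterior ℝ P)).ncard

/-- The finite sequence `(a 0, …, a d)` is unimodal. -/
def IsUnimodalSeq {α : Type*} [LE α] (d : ℕ) (a : ℕ → α) : Prop :=
  ∃ c ≤ d, (∀ i, i < c → a i ≤ a (i + 1)) ∧ (∀ i, c ≤ i → i < d → a (i + 1) ≤ a i)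

/-- The vertices `v_0, …, v_d`, `d = 2ℓ + 1`, of `P_odd(ℓ, m)`: with `M = 2(2m+1)(ℓ+1)`,
`v_0 = 0`, `v_i = e_i` for `1 ≤ i ≤ d - 1` and
`v_d = (M - 2(ℓ+1)m) e_1 + (M - 1)(e_2 + ⋯ + e_{d-1}) + M e_d`.
The index `k : Fin d` stands for the coordinate along `e_{k+1}`. -/
def vertexOdd (ℓ m : ℕ) (i : Fin (2 * ℓ + 1 + 1)) (k : Fin (2 * ℓ + 1)) : ℤ :=
  let M : ℤ := 2 * (2 * m + 1) * (ℓ + 1)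
  if (i : ℕ) < 2 * ℓ + 1 then
    (if (i : ℕ) = (k : ℕ) + 1 then 1 else 0)
  else if (k : ℕ) = 0 then M - 2 * (ℓ + 1) * m
  else if (k : ℕ) < 2 * ℓ then M - 1
  else M

/-- The vertices `v_0, …, v_d`, `d = 2ℓ + 2`, of `P_even(ℓ, m)`: with `M = 2(3m+1)(ℓ+1)`,
`v_0 = 0`, `v_i = e_i` for `1 ≤ i ≤ d - 1` and
`v_d = (M - 2(ℓ+1)m)(e_1 + e_2) + (M - 1)(e_3 + ⋯ + e_{d-1}) + M e_d`.
The index `k : Fin d` stands for the coordinate along `e_{k+1}`. -/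
def vertexEven (ℓ m : ℕ) (i : Fin (2 * ℓ + 2 + 1)) (k : Fin (2 * ℓ + 2)) : ℤ :=
  let M : ℤ := 2 * (3 * m + 1) * (ℓ + 1)
  if (i : ℕ) < 2 * ℓ + 2 then
    (if (i : ℕ) = (k : ℕ) + 1 then 1 else 0)
  else if (k : ℕ) < 2 then M - 2 * (ℓ + 1) * m
  else if (k : ℕ) < 2 * ℓ + 1 then M - 1
  else M

/-- The polytope `P_odd(ℓ, m) ⊆ ℝ^(2ℓ+1)`. -/
def polytopeOdd (ℓ m : ℕ) : Set (Fin (2 * ℓ + 1) → ℝ) :=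
  convexHull ℝ (Set.range fun i => latticeEmb (vertexOdd ℓ m i))

/-- The polytope `P_even(ℓ, m) ⊆ ℝ^(2ℓ+2)`. -/
def polytopeEven (ℓ m : ℕ) : Set (Fin (2 * ℓ + 2) → ℝ) :=
  convexHull ℝ (Set.range fun i => latticeEmb (vertexEven ℓ m i))

/-- `P` is a lattice simplex of dimension `d` with exactly `m` interior lattice points, and its
`δ`-vector `(δ_0, …, δ_d)`, given by
`(1 - t)^(d+1) (1 + ∑_{n ≥ 1} i(P, n) t^n) = δ_0 + δ_1 t + ⋯ + δ_d t^d`, is not unimodal. -/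
def IsNonUnimodalSimplex {N : ℕ} (d m : ℕ) (P : Set (Fin N → ℝ)) : Prop :=
  IsLatticeSimplex d P ∧ polytopeDim P = d ∧ interiorLatticeCount P = m ∧
    deltaSeries P =
      ∑ i ∈ Finset.range (d + 1), PowerSeries.C (delta P i) * PowerSeries.X ^ i ∧
    ¬ IsUnimodalSeq d (delta P)

/-! For a simplex with vertices `0, e_1, …, e_e, a` and `M = a_{e+1} > 0`, the half-open box of the
cone over it has one lattice point for each last coordinate `0 ≤ j < M`, and the `δ`-polynomial is
`∑_j X ^ boxHeight a M j` (`deltaSeries_hermiteSimplex`).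

Both families have the same form: `p = 1` (odd) or `p = 2` (even), `q = (p+1)m + 1` and `M =
2(ℓ+1)q`. The height of `j` is then the ceiling of `(ℓj + p(ℓ+1)(mj mod q)) / ((ℓ+1)q)`. Write `j =
v + qu` with `0 ≤ v < q` and `0 ≤ u < 2ℓ+2`. For fixed `v`, as `u` varies, the heights run once
through `t+1, …, t+2ℓ`, with two extra hits at `t+b` and `t+b+ℓ` (`sum_height_eq`). For `v = 0` one
has `t = b = 0`; for `v > 0` one has `2 ≤ t+b ≤ ℓ` (`exists_profile`). Hence the extra hits avoid
`1` and `ℓ+1`, and each of the `q` classes contributes at most `1` to `δ_1` and `δ_{ℓ+1}`, but at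
least `1` to `δ_ℓ, δ_{ℓ+2}, …, δ_{2ℓ}`. The class `v = 0` gives `δ_ℓ > q`, and `v = 1` gives some
later `δ_i > q`: there is a valley at `ℓ+1`. -/

/-- The vertices `0, e_1, …, e_e, a` of a lattice simplex in `ℝ^(e+1)` in Hermite normal form. -/
def hermiteVertex {e : ℕ} (a : Fin (e + 1) → ℤ) (i : Fin (e + 2)) (k : Fin (e + 1)) : ℤ :=
  if (i : ℕ) < e + 1 then (if (i : ℕ) = (k : ℕ) + 1 then 1 else 0) else a k

/-- The simplex with vertices `0, e_1, …, e_e, a`. -/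
def hermiteSimplex {e : ℕ} (a : Fin (e + 1) → ℤ) : Set (Fin (e + 1) → ℝ) :=
  convexHull ℝ (Set.range fun i => latticeEmb (hermiteVertex a i))

/-- The barycentric coordinates of `x` with respect to `0, e_1, …, e_e, a`. -/
noncomputable def hermiteCoord {e : ℕ} (a : Fin (e + 1) → ℤ) (x : Fin (e + 1) → ℝ) :
    Fin (e + 2) → ℝ :=
  Fin.cons
    (1 - x (Fin.last e) / a (Fin.last e) -
      ∑ k : Fin e, (x k.castSucc - a k.castSucc * x (Fin.last e) / a (Fin.last e)))
    (Fin.snoc (fun k : Fin e => x k.castSucc - a k.castSucc * x (Fin.last e) / a (Fin.last e))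
      (x (Fin.last e) / a (Fin.last e)))

/-! ### Barycentric coordinates and lattice points of dilates. -/

section Geometry

variable {e : ℕ} {a : Fin (e + 1) → ℤ}

lemma hermiteVertex_zero (k : Fin (e + 1)) : hermiteVertex a 0 k = 0 := by
  simp [hermiteVertex]

lemma hermiteVertex_castSucc (i : Fin e) (k : Fin (e + 1)) :
    hermiteVertex a i.castSucc.succ k = if k = i.castSucc then 1 else 0 := by
  simp [hermiteVertex, Fin.ext_iff, eq_comm]

lemma hermiteVertex_last (k : Fin (e + 1)) : hermiteVertex a (Fin.last e).succ k = a k := by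
  simp [hermiteVertex]

lemma sum_hermiteCoord (x : Fin (e + 1) → ℝ) : ∑ i, hermiteCoord a x i = 1 := by
  rw [Fin.sum_univ_succ, Fin.sum_univ_castSucc]
  simp only [hermiteCoord, Fin.cons_zero, Fin.cons_succ, Fin.snoc_castSucc, Fin.snoc_last]
  ring

lemma sum_hermiteCoord_smul (ha : a (Fin.last e) ≠ 0) (x : Fin (e + 1) → ℝ) :
    ∑ i, hermiteCoord a x i • latticeEmb (hermiteVertex a i) = x := by
  have ha' : (a (Fin.last e) : ℝ) ≠ 0 := by exact_mod_cast ha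
  ext k
  rw [Fin.sum_univ_succ, Fin.sum_univ_castSucc]
  simp only [hermiteCoord, latticeEmb, Fin.cons_zero, Fin.cons_succ, Fin.snoc_castSucc,
    Fin.snoc_last, Pi.add_apply, Pi.smul_apply, Finset.sum_apply, smul_eq_mul,
    hermiteVertex_zero, hermiteVertex_castSucc, hermiteVertex_last]
  induction k using Fin.lastCases with
  | last =>
    have h : ∀ i : Fin e, Fin.last e ≠ i.castSucc := fun i => (Fin.castSucc_lt_last i).ne'
    simp [h, ha']
  | cast k =>
    simp [eq_comm (a := k)]
    field_simp
    ring

lemma affineSpan_hermiteVertex (ha : a (Fin.last e) ≠ 0) :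
    affineSpan ℝ (Set.range fun i => latticeEmb (hermiteVertex a i)) = ⊤ := by
  rw [eq_top_iff]
  intro x _
  have h := sum_hermiteCoord_smul ha x
  rw [← Finset.affineCombination_eq_linear_combination _ _ _ (sum_hermiteCoord x)] at h
  rw [← h]
  exact affineCombination_mem_affineSpan (sum_hermiteCoord x) _

lemma affineIndependent_hermiteVertex (ha : a (Fin.last e) ≠ 0) :
    AffineIndependent ℝ (fun i => latticeEmb (hermiteVertex a i)) := by
  rw [affineIndependent_iff_finrank_vectorSpan_eq ℝ _ (n := e + 1) (by simp),
    ← direction_affineSpan, affineSpan_hermiteVertex ha,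
    AffineSubspace.direction_top, finrank_top, Module.finrank_fin_fun]

/-- The vertices of `hermiteSimplex a` as an affine basis. -/
noncomputable def hermiteBasis (ha : a (Fin.last e) ≠ 0) :
    AffineBasis (Fin (e + 2)) ℝ (Fin (e + 1) → ℝ) :=
  ⟨fun i => latticeEmb (hermiteVertex a i), affineIndependent_hermiteVertex ha,
    affineSpan_hermiteVertex ha⟩

lemma hermiteBasis_coord (ha : a (Fin.last e) ≠ 0) (i : Fin (e + 2)) (x : Fin (e + 1) → ℝ) :
    (hermiteBasis ha).coord i x = hermiteCoord a x i := by
  have h := sum_hermiteCoord_smul ha x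
  rw [← Finset.affineCombination_eq_linear_combination _ _ _ (sum_hermiteCoord x)] at h
  conv_lhs => rw [← h]
  exact (hermiteBasis ha).coord_apply_combination_of_mem (Finset.mem_univ i) (sum_hermiteCoord x)

lemma mem_hermiteSimplex (ha : a (Fin.last e) ≠ 0) (x : Fin (e + 1) → ℝ) :
    x ∈ hermiteSimplex a ↔ ∀ i, 0 ≤ hermiteCoord a x i := by
  have h := (hermiteBasis ha).convexHull_eq_nonneg_coord
  have h' : hermiteSimplex a = convexHull ℝ (Set.range (hermiteBasis ha)) := rfl
  rw [h', h]
  simp [hermiteBasis_coord]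

lemma affineSpan_hermiteSimplex (ha : a (Fin.last e) ≠ 0) :
    affineSpan ℝ (hermiteSimplex a) = ⊤ := by
  rw [hermiteSimplex, affineSpan_convexHull, affineSpan_hermiteVertex ha]

lemma polytopeDim_hermiteSimplex (ha : a (Fin.last e) ≠ 0) :
    polytopeDim (hermiteSimplex a) = e + 1 := by
  rw [polytopeDim, ← direction_affineSpan, affineSpan_hermiteSimplex ha,
    AffineSubspace.direction_top, finrank_top, Module.finrank_fin_fun]

lemma isLatticeSimplex_hermiteSimplex (ha : a (Fin.last e) ≠ 0) :
    IsLatticeSimplex (e + 1) (hermiteSimplex a) :=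
  ⟨hermiteVertex a, affineIndependent_hermiteVertex ha, rfl⟩

/-- The affine span is open in `V`, so its inclusion is an open map and carries relative interiors
into interiors. -/
lemma intrinsicInterior_eq_interior_of_affineSpan_eq_top {V : Type*} [NormedAddCommGroup V]
    [NormedSpace ℝ V] {s : Set V} (hs : affineSpan ℝ s = ⊤) :
    intrinsicInterior ℝ s = interior s := by
  refine Set.Subset.antisymm ?_ interior_subset_intrinsicInterior
  have ho : IsOpen ((affineSpan ℝ s : AffineSubspace ℝ V) : Set V) := by simp [hs]
  rintro _ ⟨y, hy, rfl⟩
  have h := ho.isOpenMap_subtype_val.image_interior_subset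
    ((↑) ⁻¹' s : Set (affineSpan ℝ s))
  exact interior_mono (Set.image_preimage_subset _ _) (h ⟨y, hy, rfl⟩)

lemma mem_intrinsicInterior_hermiteSimplex (ha : a (Fin.last e) ≠ 0) (x : Fin (e + 1) → ℝ) :
    x ∈ intrinsicInterior ℝ (hermiteSimplex a) ↔ ∀ i, 0 < hermiteCoord a x i := by
  rw [intrinsicInterior_eq_interior_of_affineSpan_eq_top (affineSpan_hermiteSimplex ha)]
  have h := (hermiteBasis ha).interior_convexHull
  have h' : hermiteSimplex a = convexHull ℝ (Set.range (hermiteBasis ha)) := rfl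
  rw [h', h]
  simp [hermiteBasis_coord]

/-- Scaling the barycentric coordinates of `x / n` by `n * a (Fin.last e)` clears all denominators;
the last inequality comes from the vertex `0`. -/
lemma mem_latticePoints_smul_hermiteSimplex (ha : 0 < a (Fin.last e)) {n : ℕ} (hn : n ≠ 0)
    (x : Fin (e + 1) → ℤ) :
    x ∈ latticePoints ((n : ℝ) • hermiteSimplex a) ↔
      0 ≤ x (Fin.last e) ∧
      (∀ k : Fin e, a k.castSucc * x (Fin.last e) ≤ a (Fin.last e) * x k.castSucc) ∧
      x (Fin.last e) +
        ∑ k : Fin e, (a (Fin.last e) * x k.castSucc - a k.castSucc * x (Fin.last e)) ≤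
          n * a (Fin.last e) := by
  have ha' : (0 : ℝ) < a (Fin.last e) := by exact_mod_cast ha
  have hn' : (0 : ℝ) < n := by exact_mod_cast Nat.pos_of_ne_zero hn
  have hs : ∀ k : Fin e, ((n : ℝ)⁻¹ * x k.castSucc -
      a k.castSucc * ((n : ℝ)⁻¹ * x (Fin.last e)) / a (Fin.last e)) =
      ((n : ℝ) * a (Fin.last e))⁻¹ *
        (a (Fin.last e) * x k.castSucc - a k.castSucc * x (Fin.last e)) := by
    intro k
    field_simp
  have h0 : (1 : ℝ) - (n : ℝ)⁻¹ * x (Fin.last e) / a (Fin.last e) -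
      ∑ k : Fin e, ((n : ℝ) * a (Fin.last e))⁻¹ *
        (a (Fin.last e) * x k.castSucc - a k.castSucc * x (Fin.last e)) =
      ((n : ℝ) * a (Fin.last e))⁻¹ * (n * a (Fin.last e) - (x (Fin.last e) +
        ∑ k : Fin e, ((a (Fin.last e) : ℝ) * x k.castSucc - a k.castSucc * x (Fin.last e)))) := by
    rw [← Finset.mul_sum]
    field_simp
    ring
  have hl : (n : ℝ)⁻¹ * x (Fin.last e) / a (Fin.last e) =
      ((n : ℝ) * a (Fin.last e))⁻¹ * x (Fin.last e) := by
    field_simp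
  have hp : 0 < ((n : ℝ) * a (Fin.last e))⁻¹ := by positivity
  rw [latticePoints, Set.mem_ofPred_eq, Set.mem_smul_set_iff_inv_smul_mem₀ hn'.ne',
    mem_hermiteSimplex ha.ne', Fin.forall_fin_succ, Fin.forall_fin_succ']
  simp only [hermiteCoord, latticeEmb, Fin.cons_zero, Fin.cons_succ, Fin.snoc_castSucc,
    Fin.snoc_last, Pi.smul_apply, smul_eq_mul]
  simp only [hs, h0]
  simp only [hl, mul_nonneg_iff_of_pos_left hp, sub_nonneg]
  norm_cast
  tauto

lemma mem_latticePoints_interior_hermiteSimplex (ha : 0 < a (Fin.last e))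
    (x : Fin (e + 1) → ℤ) :
    x ∈ latticePoints (intrinsicInterior ℝ (hermiteSimplex a)) ↔
      0 < x (Fin.last e) ∧
      (∀ k : Fin e, a k.castSucc * x (Fin.last e) < a (Fin.last e) * x k.castSucc) ∧
      x (Fin.last e) +
        ∑ k : Fin e, (a (Fin.last e) * x k.castSucc - a k.castSucc * x (Fin.last e)) <
          a (Fin.last e) := by
  have ha' : (0 : ℝ) < a (Fin.last e) := by exact_mod_cast ha
  have hs : ∀ k : Fin e, ((x k.castSucc : ℝ) -
      a k.castSucc * x (Fin.last e) / a (Fin.last e)) =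
      (a (Fin.last e) : ℝ)⁻¹ *
        (a (Fin.last e) * x k.castSucc - a k.castSucc * x (Fin.last e)) := by
    intro k
    field_simp
  have h0 : (1 : ℝ) - (x (Fin.last e)) / a (Fin.last e) -
      ∑ k : Fin e, (a (Fin.last e) : ℝ)⁻¹ *
        (a (Fin.last e) * x k.castSucc - a k.castSucc * x (Fin.last e)) =
      (a (Fin.last e) : ℝ)⁻¹ * (a (Fin.last e) - (x (Fin.last e) +
        ∑ k : Fin e, ((a (Fin.last e) : ℝ) * x k.castSucc - a k.castSucc * x (Fin.last e)))) := by
    rw [← Finset.mul_sum]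
    field_simp
    ring
  have hl : (x (Fin.last e) : ℝ) / a (Fin.last e) =
      (a (Fin.last e) : ℝ)⁻¹ * x (Fin.last e) := by
    field_simp
  have hp : 0 < (a (Fin.last e) : ℝ)⁻¹ := by positivity
  rw [latticePoints, Set.mem_ofPred_eq, mem_intrinsicInterior_hermiteSimplex ha.ne',
    Fin.forall_fin_succ, Fin.forall_fin_succ']
  simp only [hermiteCoord, latticeEmb, Fin.cons_zero, Fin.cons_succ, Fin.snoc_castSucc,
    Fin.snoc_last]
  simp only [hs, h0]
  simp only [hl, mul_pos_iff_of_pos_left hp, sub_pos]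
  norm_cast
  tauto

end Geometry

/-- `M = a_{e+1}` times the sum of the barycentric coordinates, other than the one at `0`, of the
box point with last coordinate `j` of the simplex `0, e_1, …, e_e, a`. -/
def boxSum {e : ℕ} (a : Fin (e + 1) → ℤ) (M j : ℕ) : ℕ :=
  j + ∑ k : Fin e, (-(a k.castSucc * j) % M).toNat

/-- The height of the box point with last coordinate `j`. -/
def boxHeight {e : ℕ} (a : Fin (e + 1) → ℤ) (M j : ℕ) : ℕ :=
  boxSum a M j ⌈/⌉ M

/-- The lattice point obtained by translating the box point with last coordinate `j` by nonnegative
multiples of the vertices. -/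
def translatedBoxPoint {e : ℕ} (a : Fin (e + 1) → ℤ) (M j : ℕ) (c : Fin (e + 2) → ℕ) :
    Fin (e + 1) → ℤ :=
  Fin.snoc (fun k : Fin e => (c k.castSucc.succ : ℤ) - -(a k.castSucc * j) / M +
    a k.castSucc * c (Fin.last e).succ) (M * c (Fin.last e).succ + j)

/-! ### The `δ`-polynomial as a sum over box points. -/

section Ehrhart

variable {e : ℕ} {a : Fin (e + 1) → ℤ} {M : ℕ}

lemma boxSum_cast (hM : 0 < M) (j : ℕ) :
    (boxSum a M j : ℤ) = j + ∑ k : Fin e, -(a k.castSucc * j) % M := by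
  have hM' : (M : ℤ) ≠ 0 := by exact_mod_cast hM.ne'
  simp only [boxSum, Nat.cast_add, Nat.cast_sum]
  congr 1
  exact Finset.sum_congr rfl fun k _ => Int.toNat_of_nonneg (Int.emod_nonneg _ hM')

lemma boxHeight_le_iff (hM : 0 < M) (j n : ℕ) : boxHeight a M j ≤ n ↔ boxSum a M j ≤ M * n :=
  ceilDiv_le_iff_le_mul hM

lemma boxHeight_le (hM : 0 < M) {j : ℕ} (hj : j < M) : boxHeight a M j ≤ e + 1 := by
  rw [boxHeight_le_iff hM]
  have h : ∑ k : Fin e, (-(a k.castSucc * j) % M).toNat ≤ ∑ _k : Fin e, M := by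
    refine Finset.sum_le_sum fun k _ => ?_
    have := Int.emod_lt_of_pos (-(a k.castSucc * j)) (Int.natCast_pos.2 hM)
    omega
  simp only [Finset.sum_const, Finset.card_univ, Fintype.card_fin, smul_eq_mul] at h
  rw [boxSum]
  nlinarith

lemma translatedBoxPoint_last (j : ℕ) (c : Fin (e + 2) → ℕ) :
    translatedBoxPoint a M j c (Fin.last e) = M * c (Fin.last e).succ + j := by
  simp [translatedBoxPoint]

lemma mul_translatedBoxPoint_sub (j : ℕ) (c : Fin (e + 2) → ℕ) (k : Fin e) :
    M * translatedBoxPoint a M j c k.castSucc -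
      a k.castSucc * translatedBoxPoint a M j c (Fin.last e) =
      M * c k.castSucc.succ + -(a k.castSucc * j) % M := by
  simp only [translatedBoxPoint, Fin.snoc_castSucc, Fin.snoc_last]
  have h := Int.emod_add_mul_ediv (-(a k.castSucc * j)) M
  linear_combination -h

lemma translatedBoxPoint_sum (hM : 0 < M) (j : ℕ) (c : Fin (e + 2) → ℕ) :
    translatedBoxPoint a M j c (Fin.last e) +
      ∑ k : Fin e, (M * translatedBoxPoint a M j c k.castSucc -
        a k.castSucc * translatedBoxPoint a M j c (Fin.last e)) =
      ((boxSum a M j + M * ∑ i : Fin (e + 1), c i.succ : ℕ) : ℤ) := by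
  simp only [mul_translatedBoxPoint_sub]
  push_cast
  rw [boxSum_cast hM, translatedBoxPoint_last, Finset.sum_add_distrib, Fin.sum_univ_castSucc,
    ← Finset.mul_sum]
  ring

/-- Reducing the last coordinate modulo `M` recovers `j`. The multiplicity `c 0` belongs to the
vertex `0`, so the point does not determine it. -/
lemma translatedBoxPoint_inj (hM : 0 < M) {j j' : ℕ} (hj : j < M) (hj' : j' < M)
    {c c' : Fin (e + 2) → ℕ}
    (h : translatedBoxPoint a M j c = translatedBoxPoint a M j' c') :
    j = j' ∧ ∀ i : Fin (e + 1), c i.succ = c' i.succ := by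
  have hl : M * c (Fin.last e).succ + j = M * c' (Fin.last e).succ + j' := by
    have := congrFun h (Fin.last e)
    rw [translatedBoxPoint_last, translatedBoxPoint_last] at this
    exact_mod_cast this
  have hjj : j = j' := by
    have := congrArg (· % M) hl
    simpa [Nat.mul_add_mod, Nat.mod_eq_of_lt hj, Nat.mod_eq_of_lt hj'] using this
  subst hjj
  refine ⟨rfl, fun i => ?_⟩
  induction i using Fin.lastCases with
  | last => exact Nat.eq_of_mul_eq_mul_left hM (by omega)
  | cast k =>
    have h1 := mul_translatedBoxPoint_sub (a := a) (M := M) j c k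
    rw [h, mul_translatedBoxPoint_sub] at h1
    have h2 : (M : ℤ) * c' k.castSucc.succ = M * c k.castSucc.succ := by linarith
    have h3 : M * c' k.castSucc.succ = M * c k.castSucc.succ := by exact_mod_cast h2
    exact (Nat.eq_of_mul_eq_mul_left hM h3).symm

lemma exists_translatedBoxPoint (hM : 0 < M) {x : Fin (e + 1) → ℤ} (h0 : 0 ≤ x (Fin.last e))
    (h : ∀ k : Fin e, a k.castSucc * x (Fin.last e) ≤ M * x k.castSucc) (c₀ : ℕ) :
    ∃ j < M, ∃ c : Fin (e + 1) → ℕ, translatedBoxPoint a M j (Fin.cons c₀ c) = x := by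
  have hM' : (0 : ℤ) < M := by exact_mod_cast hM
  obtain ⟨j, hj⟩ := Int.eq_ofNat_of_zero_le (Int.emod_nonneg (x (Fin.last e)) hM'.ne')
  obtain ⟨t, ht⟩ := Int.eq_ofNat_of_zero_le (Int.ediv_nonneg h0 hM'.le)
  have hjM : j < M := by
    have := Int.emod_lt_of_pos (x (Fin.last e)) hM'
    omega
  have hx : x (Fin.last e) = M * t + j := by
    have := Int.emod_add_mul_ediv (x (Fin.last e)) M
    rw [hj, ht] at this
    linarith
  have hk : ∀ k : Fin e, ∃ c : ℕ,
      x k.castSucc + -(a k.castSucc * j) / M - a k.castSucc * t = c := by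
    intro k
    refine Int.eq_ofNat_of_zero_le ?_
    have h1 := h k
    rw [hx] at h1
    have h2 := Int.emod_add_mul_ediv (-(a k.castSucc * j)) M
    have h3 := Int.emod_lt_of_pos (-(a k.castSucc * j)) hM'
    -- A multiplicity at most `-1` would outweigh the residue, which is less than `M`, against `h1`.
    by_contra hneg
    nlinarith
  choose c hc using hk
  refine ⟨j, hjM, Fin.snoc c t, ?_⟩
  ext i
  induction i using Fin.lastCases with
  | last => simp [translatedBoxPoint, hx]
  | cast k =>
    simp only [translatedBoxPoint, Fin.snoc_castSucc, Fin.snoc_last, Fin.cons_succ]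
    rw [← hc k]
    ring

/-- Pairs of a box point and a family of multiplicities parametrizing the lattice points of the
`n`-th dilate. -/
def dilateIndex (a : Fin (e + 1) → ℤ) (M n : ℕ) : Finset (Σ _ : ℕ, Fin (e + 2) →₀ ℕ) :=
  (Finset.range M).sigma fun j =>
    if boxHeight a M j ≤ n then Finset.univ.finsuppAntidiag (n - boxHeight a M j) else ∅

lemma mem_dilateIndex {n j : ℕ} {c : Fin (e + 2) →₀ ℕ} :
    ⟨j, c⟩ ∈ dilateIndex a M n ↔ j < M ∧ boxHeight a M j + ∑ i, c i = n := by
  simp only [dilateIndex, Finset.mem_sigma, Finset.mem_range]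
  refine and_congr_right fun _ => ?_
  split_ifs with h
  · simp only [Finset.mem_finsuppAntidiag, Finset.subset_univ, and_true]
    change ∑ i, c i = _ ↔ _
    omega
  · simp only [Finset.notMem_empty, false_iff]
    omega

/-- The multiplicity `c 0` takes up the slack `n - boxHeight - ∑ c`, turning the inequality of the
dilate into an equality and making the parametrization bijective. -/
lemma ehrhartCount_hermiteSimplex (hM : 0 < M) (ha : a (Fin.last e) = M) {n : ℕ} (hn : n ≠ 0) :
    ehrhartCount (hermiteSimplex a) n = (dilateIndex a M n).card := by
  have hM' : (0 : ℤ) < a (Fin.last e) := by rw [ha]; exact_mod_cast hM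
  have himg : latticePoints ((n : ℝ) • hermiteSimplex a) =
      ((dilateIndex a M n).image fun p => translatedBoxPoint a M p.1 p.2 : Finset _) := by
    ext x
    rw [mem_latticePoints_smul_hermiteSimplex hM' hn, ha]
    simp only [Finset.coe_image, Set.mem_image, SetLike.mem_coe, Sigma.exists, mem_dilateIndex]
    constructor
    · rintro ⟨h0, h1, h2⟩
      obtain ⟨j, hj, c, rfl⟩ := exists_translatedBoxPoint hM h0 h1 0
      rw [translatedBoxPoint_sum hM] at h2
      simp only [Fin.cons_succ] at h2
      have h3 : boxSum a M j + M * ∑ i, c i ≤ M * n := by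
        rw [mul_comm M n]
        exact_mod_cast h2
      have h4 : ∑ i, c i ≤ n := Nat.le_of_mul_le_mul_left (by omega) hM
      have h5 : boxHeight a M j ≤ n - ∑ i, c i := by
        rw [boxHeight_le_iff hM, Nat.mul_sub]
        omega
      refine ⟨j, Finsupp.equivFunOnFinite.symm
        (Fin.cons (n - ∑ i, c i - boxHeight a M j) c), ⟨hj, ?_⟩, ?_⟩
      · rw [Fin.sum_univ_succ]
        simp only [Finsupp.equivFunOnFinite_symm_apply_apply, Fin.cons_zero, Fin.cons_succ]
        omega
      · ext i
        simp [translatedBoxPoint]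
    · rintro ⟨j, c, ⟨hj, hc⟩, rfl⟩
      rw [translatedBoxPoint_sum hM]
      rw [Fin.sum_univ_succ] at hc
      refine ⟨?_, fun k => ?_, ?_⟩
      · rw [translatedBoxPoint_last]
        positivity
      · rw [← sub_nonneg, mul_translatedBoxPoint_sub]
        have := Int.emod_nonneg (-(a k.castSucc * j)) (by omega : (M : ℤ) ≠ 0)
        positivity
      · have h := (boxHeight_le_iff (a := a) hM j _).1 le_rfl
        rw [mul_comm (n : ℤ), ← hc]
        norm_cast
        nlinarith
  rw [ehrhartCount, himg, Set.ncard_coe_finset, Finset.card_image_of_injOn]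
  rintro ⟨j, c⟩ hp ⟨j', c'⟩ hp' h
  rw [SetLike.mem_coe, mem_dilateIndex, Fin.sum_univ_succ] at hp hp'
  obtain ⟨rfl, hc⟩ := translatedBoxPoint_inj hM hp.1 hp'.1 h
  simp only [hc] at hp
  have : c = c' := by
    ext i
    refine Fin.cases ?_ hc i
    omega
  rw [this]

lemma boxHeight_eq_zero_iff (hM : 0 < M) (j : ℕ) : boxHeight a M j = 0 ↔ j = 0 := by
  rw [← Nat.le_zero, boxHeight_le_iff hM]
  constructor
  · intro h
    rw [boxSum] at h
    omega
  · rintro rfl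
    simp [boxSum]

lemma card_dilateIndex_zero (hM : 0 < M) : (dilateIndex a M 0).card = 1 := by
  rw [Finset.card_eq_one]
  refine ⟨⟨0, 0⟩, ?_⟩
  ext ⟨j, c⟩
  rw [mem_dilateIndex, Nat.add_eq_zero_iff, boxHeight_eq_zero_iff hM, Finset.mem_singleton,
    Finset.sum_eq_zero_iff]
  constructor
  · rintro ⟨_, rfl, hc⟩
    have : c = 0 := by
      ext i
      simpa using hc i (Finset.mem_univ i)
    rw [this]
  · rintro h
    cases h
    simp [hM]

lemma card_dilateIndex (n : ℕ) : ((dilateIndex a M n).card : ℤ) =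
    ∑ j ∈ Finset.range M, if boxHeight a M j ≤ n then
      ((e + 1 + (n - boxHeight a M j)).choose (e + 1) : ℤ) else 0 := by
  rw [dilateIndex, Finset.card_sigma]
  push_cast
  refine Finset.sum_congr rfl fun j _ => ?_
  split_ifs with h
  · rw [Finset.card_finsuppAntidiag_nat_eq_choose, Finset.card_univ, Fintype.card_fin]
    rw [show e + 2 + (n - boxHeight a M j) - 1 = (n - boxHeight a M j) + (e + 1) by omega,
      Nat.choose_symm_add, add_comm (e + 1)]
  · simp

open PowerSeries in
-- A box point of height `h` together with its translates contributes `X ^ h / (1 - X) ^ (e + 2)` to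
-- the Ehrhart series.
theorem deltaSeries_hermiteSimplex (hM : 0 < M) (ha : a (Fin.last e) = M) :
    deltaSeries (hermiteSimplex a) = ∑ j ∈ Finset.range M, X ^ boxHeight a M j := by
  have hM' : a (Fin.last e) ≠ 0 := by rw [ha]; exact_mod_cast hM.ne'
  have h : ehrhartSeries (hermiteSimplex a) =
      (∑ j ∈ Finset.range M, X ^ boxHeight a M j) *
        mk fun n => ((e + 1 + n).choose (e + 1) : ℤ) := by
    ext n
    rw [Finset.sum_mul, map_sum]
    simp only [coeff_X_pow_mul', coeff_mk, ehrhartSeries]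
    rw [← card_dilateIndex]
    split_ifs with hn
    · rw [hn, card_dilateIndex_zero hM, Nat.cast_one]
    · rw [ehrhartCount_hermiteSimplex hM ha hn]
  rw [deltaSeries, polytopeDim_hermiteSimplex hM', h, mul_comm, mul_assoc,
    mk_add_choose_mul_one_sub_pow_eq_one ℤ (e + 1), mul_one]

theorem delta_hermiteSimplex (hM : 0 < M) (ha : a (Fin.last e) = M) (i : ℕ) :
    delta (hermiteSimplex a) i =
      ∑ j ∈ Finset.range M, if i = boxHeight a M j then 1 else 0 := by
  rw [delta, deltaSeries_hermiteSimplex hM ha, map_sum]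
  simp [PowerSeries.coeff_X_pow]

theorem deltaSeries_hermiteSimplex_eq_sum_delta (hM : 0 < M) (ha : a (Fin.last e) = M) :
    deltaSeries (hermiteSimplex a) = ∑ i ∈ Finset.range (e + 1 + 1),
      PowerSeries.C (delta (hermiteSimplex a) i) * PowerSeries.X ^ i := by
  ext n
  rw [map_sum]
  simp only [PowerSeries.coeff_C_mul_X_pow]
  rw [Finset.sum_ite_eq]
  split_ifs with h
  · rfl
  · change delta (hermiteSimplex a) n = 0
    rw [delta_hermiteSimplex hM ha]
    refine Finset.sum_eq_zero fun j hj => if_neg ?_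
    have := boxHeight_le (a := a) hM (Finset.mem_range.1 hj)
    rw [Finset.mem_range] at h
    omega

/-- A scaled coordinate sum below `M` leaves no room for a translation by a nonzero vertex, so
interior points are box points; positivity of a coordinate then says that its residue is nonzero. -/
theorem interiorLatticeCount_hermiteSimplex (hM : 0 < M) (ha : a (Fin.last e) = M) :
    interiorLatticeCount (hermiteSimplex a) = ((Finset.range M).filter fun j : ℕ =>
      0 < j ∧ (∀ k : Fin e, ¬ (M : ℤ) ∣ a k.castSucc * j) ∧ boxSum a M j < M).card := by
  have hM' : (0 : ℤ) < a (Fin.last e) := by rw [ha]; exact_mod_cast hM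
  have himg : latticePoints (intrinsicInterior ℝ (hermiteSimplex a)) =
      (((Finset.range M).filter fun j : ℕ =>
      0 < j ∧ (∀ k : Fin e, ¬ (M : ℤ) ∣ a k.castSucc * j) ∧ boxSum a M j < M).image
        fun j => translatedBoxPoint a M j 0 : Finset _) := by
    ext x
    rw [mem_latticePoints_interior_hermiteSimplex hM', ha]
    simp only [Finset.coe_image, Set.mem_image, SetLike.mem_coe, Finset.mem_filter,
      Finset.mem_range]
    constructor
    · rintro ⟨h0, h1, h2⟩
      obtain ⟨j, hj, c, rfl⟩ := exists_translatedBoxPoint hM h0.le (fun k => (h1 k).le) 0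
      rw [translatedBoxPoint_sum hM] at h2
      simp only [Fin.cons_succ] at h2
      have h3 : boxSum a M j + M * ∑ i, c i < M := by exact_mod_cast h2
      have h4 : ∑ i, c i = 0 := by
        by_contra hne
        have : M * 1 ≤ M * ∑ i, c i := Nat.mul_le_mul_left M (Nat.pos_of_ne_zero hne)
        omega
      have hc : (Fin.cons 0 c : Fin (e + 2) → ℕ) = 0 := by
        ext i
        refine Fin.cases rfl (fun i => ?_) i
        simpa using (Finset.sum_eq_zero_iff.1 h4) i (Finset.mem_univ i)
      rw [hc] at h0 h1
      rw [hc]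
      refine ⟨j, ⟨hj, ?_, fun k hk => ?_, ?_⟩, rfl⟩
      · rw [translatedBoxPoint_last] at h0
        simpa using h0
      · have := h1 k
        rw [← sub_pos, mul_translatedBoxPoint_sub, Int.emod_eq_zero_of_dvd (hk.neg_right)] at this
        simp at this
      · omega
    · rintro ⟨j, ⟨hj, h0, h1, h2⟩, rfl⟩
      rw [translatedBoxPoint_sum hM]
      refine ⟨?_, fun k => ?_, ?_⟩
      · rw [translatedBoxPoint_last]
        simpa using h0
      · rw [← sub_pos, mul_translatedBoxPoint_sub]
        have h3 := Int.emod_nonneg (-(a k.castSucc * j)) (by omega : (M : ℤ) ≠ 0)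
        have h4 : -(a k.castSucc * j) % (M : ℤ) ≠ 0 := fun h =>
          h1 k ((dvd_neg).1 (Int.dvd_of_emod_eq_zero h))
        simp only [Pi.zero_apply, Nat.cast_zero, mul_zero, zero_add]
        omega
      · simpa using h2
  rw [interiorLatticeCount, himg, Set.ncard_coe_finset, Finset.card_image_of_injOn]
  intro j hj j' hj' h
  simp only [Finset.coe_filter, Set.mem_ofPred_eq, Finset.mem_range] at hj hj'
  exact (translatedBoxPoint_inj hM hj.1 hj'.1 h).1

end Ehrhart

/-- The last vertex of `P_odd(ℓ, m)` (for `p = 1`) and of `P_even(ℓ, m)` (for `p = 2`). -/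
def apex {e : ℕ} (p ℓ m : ℕ) (k : Fin (e + 1)) : ℤ :=
  let M : ℤ := 2 * ((p + 1) * m + 1) * (ℓ + 1)
  if (k : ℕ) < p then M - 2 * (ℓ + 1) * m else if (k : ℕ) < e then M - 1 else M

/-- The normalized volume of the simplex with last vertex `apex p ℓ m`. -/
def apexVolume (p ℓ m : ℕ) : ℕ := 2 * (ℓ + 1) * ((p + 1) * m + 1)

lemma polytopeOdd_eq (ℓ m : ℕ) :
    polytopeOdd ℓ m = hermiteSimplex (e := 2 * ℓ) (apex 1 ℓ m) := by
  have h : vertexOdd ℓ m = hermiteVertex (e := 2 * ℓ) (apex 1 ℓ m) := by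
    ext i k
    simp [vertexOdd, hermiteVertex, apex, one_add_one_eq_two]
  rw [polytopeOdd, hermiteSimplex, h]

lemma polytopeEven_eq (ℓ m : ℕ) :
    polytopeEven ℓ m = hermiteSimplex (e := 2 * ℓ + 1) (apex 2 ℓ m) := by
  have h : vertexEven ℓ m = hermiteVertex (e := 2 * ℓ + 1) (apex 2 ℓ m) := by
    ext i k
    simp [vertexEven, hermiteVertex, apex, show (2 : ℤ) + 1 = 3 by norm_num]
    split_ifs <;> first | rfl | omega
  rw [polytopeEven, hermiteSimplex, h]

/-! ### Arithmetic of the heights in a residue class modulo `q = (p+1)m + 1`. -/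

section Residues

variable {p ℓ m : ℕ}

/-- Since `(p+1)m ≡ -1` modulo `q`, `mv ≡ -k - rm`, and `1 ≤ k + rm < q`. -/
lemma mul_mod_add_eq {k r v : ℕ} (hk : 1 ≤ k) (hkm : k ≤ m) (hr : r ≤ p)
    (hv : v + r = (p + 1) * k) :
    m * v % ((p + 1) * m + 1) + k + r * m = (p + 1) * m + 1 := by
  obtain ⟨k, rfl⟩ := Nat.exists_eq_add_of_le' hk
  have hrm : r * m ≤ p * m := Nat.mul_le_mul_right m hr
  obtain ⟨s, hs⟩ := Nat.exists_eq_add_of_le (show k + 1 + r * m ≤ (p + 1) * m + 1 by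
    rw [add_mul, one_mul]; omega)
  have h : m * v = ((p + 1) * m + 1) * k + s := by
    zify at hv hs ⊢
    linear_combination (m : ℤ) * hv + hs
  rw [h, Nat.mul_add_mod, Nat.mod_eq_of_lt (by omega)]
  omega

lemma exists_add_eq_mul {v : ℕ} (hv : 0 < v) (hvq : v < (p + 1) * m + 1) :
    ∃ k r, 1 ≤ k ∧ k ≤ m ∧ r ≤ p ∧ v + r = (p + 1) * k := by
  have h1 := Nat.mod_add_div (v - 1) (p + 1)
  have h2 := Nat.mod_lt (v - 1) p.add_one_pos
  -- Here `k` is the ceiling of `v / (p + 1)` and `r` the defect.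
  refine ⟨(v - 1) / (p + 1) + 1, p - (v - 1) % (p + 1), Nat.le_add_left 1 _, ?_, by omega, ?_⟩
  · rw [Nat.succ_le_iff, Nat.div_lt_iff_lt_mul p.add_one_pos, mul_comm m]
    omega
  · rw [mul_add, mul_one]
    omega

/-- The height numerator of the residue `v`, up to a multiple of `ℓ + 1`. -/
lemma height_numerator_eq {k r t v : ℕ} (hp : p ≤ ℓ) (hk : 1 ≤ k) (hkm : k ≤ m)
    (ht : t + r = p) (hv : v + r = (p + 1) * k) :
    ℓ * v + p * (ℓ + 1) * (m * v % ((p + 1) * m + 1)) =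
      (ℓ + 1) * t * ((p + 1) * m + 1) + ((ℓ - p) * k + r * (1 + (ℓ + 1) * m)) := by
  have h := mul_mod_add_eq hk hkm (by omega : r ≤ p) hv
  obtain ⟨s, rfl⟩ := Nat.exists_eq_add_of_le hp
  rw [Nat.add_sub_cancel_left]
  generalize m * v % ((p + 1) * m + 1) = z at h
  subst ht
  zify at h hv ⊢
  linear_combination (t + r + s : ℤ) * hv + (t + r : ℤ) * (t + r + s + 1) * h

/-- Gives `t + b ≤ ℓ` for `b` the ceiling of the left side over `q`. -/
lemma remainder_le {k r t : ℕ} (hp : p ≤ ℓ) (hkm : k ≤ m) (ht : t + r = p) :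
    (ℓ - p) * k + r * (1 + (ℓ + 1) * m) ≤ ((p + 1) * m + 1) * (ℓ - t) := by
  obtain ⟨s, rfl⟩ := Nat.exists_eq_add_of_le hp
  subst ht
  rw [Nat.add_sub_cancel_left, show t + r + s - t = r + s by omega]
  have := Nat.mul_le_mul_left s hkm
  have h2 : 0 ≤ t * s * m := Nat.zero_le _
  nlinarith

/-- The case `t = 0`: it forces `b ≥ 2`, and in the interior count it excludes `u ≥ 1`. -/
lemma lt_remainder {k r : ℕ} (hp : 1 ≤ p) (hpℓ : p ≤ ℓ) (hℓ : 2 ≤ ℓ) (hk : 1 ≤ k) (hkm : k ≤ m)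
    (hr : r = p) : (p + 1) * m + 1 < (ℓ - p) * k + r * (1 + (ℓ + 1) * m) := by
  subst hr
  obtain ⟨s, rfl⟩ := Nat.exists_eq_add_of_le hpℓ
  rw [Nat.add_sub_cancel_left]
  have h1 : 1 ≤ m := hk.trans hkm
  have h2 : r * 3 * m ≤ r * (r + s + 1) * m :=
    Nat.mul_le_mul_right m (Nat.mul_le_mul_left r (by omega))
  nlinarith [Nat.mul_le_mul hp h1, Nat.zero_le (s * k)]

lemma exists_profile {v : ℕ} (hp : 1 ≤ p) (hpℓ : p ≤ ℓ) (hℓ : 2 ≤ ℓ) (hv : 0 < v)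
    (hvq : v < (p + 1) * m + 1) :
    ∃ t b, 2 ≤ t + b ∧ t + b ≤ ℓ ∧ ∀ u n,
      ℓ * (v + ((p + 1) * m + 1) * u) +
          p * (ℓ + 1) * (m * (v + ((p + 1) * m + 1) * u) % ((p + 1) * m + 1)) ≤
        (ℓ + 1) * ((p + 1) * m + 1) * n ↔
      ℓ * u + (ℓ + 1) * t + b ≤ (ℓ + 1) * n := by
  obtain ⟨k, r, hk, hkm, hr, hvr⟩ := exists_add_eq_mul hv hvq
  obtain ⟨t, ht⟩ := Nat.exists_eq_add_of_le' hr
  have hnum := height_numerator_eq hpℓ hk hkm ht.symm hvr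
  have hle := remainder_le hpℓ hkm ht.symm
  have hlt : r = p → _ := lt_remainder hp hpℓ hℓ hk hkm
  have hpos : t = 1 → 0 < (ℓ - p) * k + r * (1 + (ℓ + 1) * m) := by
    intro ht1
    rcases Nat.eq_zero_or_pos r with h0 | h0
    · have : 0 < (ℓ - p) * k := Nat.mul_pos (by omega) hk
      omega
    · have : 0 < r * (1 + (ℓ + 1) * m) := Nat.mul_pos h0 (by omega)
      omega
  generalize (ℓ - p) * k + r * (1 + (ℓ + 1) * m) = w at *
  have hq : 0 < (p + 1) * m + 1 := Nat.add_one_pos _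
  have hmod : ∀ u, m * (v + ((p + 1) * m + 1) * u) % ((p + 1) * m + 1) =
      m * v % ((p + 1) * m + 1) := fun u => by
    rw [mul_add, mul_left_comm, Nat.add_mul_mod_self_left]
  simp only [hmod]
  generalize (p + 1) * m + 1 = q at *
  have hb : ∀ n, w ⌈/⌉ q ≤ n ↔ w ≤ q * n := fun n => ceilDiv_le_iff_le_mul hq
  refine ⟨t, w ⌈/⌉ q, ?_, ?_, fun u n => ?_⟩
  -- Only `t = 0, b ≤ 1` and `t = 1, b = 0` need excluding; `hlt` and `hpos` do so.
  · by_contra hcon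
    rcases Nat.lt_or_ge t 1 with h | h
    · have := (hb 1).1 (by omega)
      have := hlt (by omega)
      omega
    · have := (hb 0).1 (by omega)
      have := hpos (by omega)
      omega
  · have := (hb (ℓ - t)).2 hle
    omega
  · have h1 : ℓ * (v + q * u) + p * (ℓ + 1) * (m * v % q) =
        q * (ℓ * u + (ℓ + 1) * t) + w := by
      linear_combination hnum
    rw [h1]
    rcases Nat.lt_or_ge ((ℓ + 1) * n) (ℓ * u + (ℓ + 1) * t) with h | h
    · refine iff_of_false (fun h' => ?_) (by omega)
      have := Nat.mul_lt_mul_of_pos_left h hq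
      have h2 : (ℓ + 1) * q * n = q * ((ℓ + 1) * n) := by ring
      omega
    · obtain ⟨z, hz⟩ := Nat.exists_eq_add_of_le h
      rw [show (ℓ + 1) * q * n = q * ((ℓ + 1) * n) by ring, hz, mul_add q _ z,
        Nat.add_le_add_iff_left, Nat.add_le_add_iff_left, hb]

lemma sum_range_ite_eq_add (i s n : ℕ) :
    ∑ u ∈ Finset.range n, (if i = s + u then (1 : ℤ) else 0) =
      if s ≤ i ∧ i < s + n then 1 else 0 := by
  induction n with
  | zero => simp
  | succ n ih =>
    rw [Finset.sum_range_succ, ih]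
    split_ifs <;> omega

/-- `H u` is `t` plus the ceiling of `(ℓu + b) / (ℓ + 1)`. It grows by one at each step, except that
it repeats a value on passing to `u = b` (for `b > 0`) and to `u = b + ℓ + 1`; the three runs
between these are summed separately. -/
lemma sum_height_eq {t b : ℕ} (hb : b ≤ ℓ + 1) {H : ℕ → ℕ}
    (hH : ∀ u n, H u ≤ n ↔ ℓ * u + (ℓ + 1) * t + b ≤ (ℓ + 1) * n) (i : ℕ) :
    ∑ u ∈ Finset.range (2 * ℓ + 2), (if i = H u then (1 : ℤ) else 0) =
      (if t + 1 ≤ i ∧ i ≤ t + 2 * ℓ then 1 else 0) + (if i = t + b then 1 else 0) +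
        (if i = t + b + ℓ then 1 else 0) := by
  have heq : ∀ u n, H u = n + 1 ↔
      ℓ * u + (ℓ + 1) * t + b ≤ (ℓ + 1) * (n + 1) ∧
        (ℓ + 1) * n < ℓ * u + (ℓ + 1) * t + b := by
    intro u n
    rw [← hH, ← not_le, ← hH]
    omega
  have h1 : ∀ u ∈ Finset.range b, H u = t + 1 + u := by
    intro u hu
    rw [Finset.mem_range] at hu
    rw [show t + 1 + u = t + u + 1 by omega, heq]
    constructor <;> nlinarith
  have h2 : ∀ u ∈ Finset.range (ℓ + 1), H (b + u) = t + b + u := by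
    intro u hu
    rw [Finset.mem_range] at hu
    refine le_antisymm ((hH _ _).2 (by nlinarith)) ?_
    by_contra hcon
    have h := (hH (b + u) (t + b + u - 1)).1 (by omega)
    obtain ⟨z, hz⟩ : ∃ z, t + b + u = z + 1 := ⟨t + b + u - 1, by omega⟩
    rw [hz, Nat.add_sub_cancel] at h
    nlinarith
  have h3 : ∀ u ∈ Finset.range (ℓ + 1 - b), H (b + (ℓ + 1) + u) = t + b + ℓ + u := by
    intro u hu
    rw [Finset.mem_range, Nat.lt_sub_iff_add_lt] at hu
    refine le_antisymm ((hH _ _).2 (by nlinarith)) ?_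
    by_contra hcon
    have h := (hH (b + (ℓ + 1) + u) (t + b + ℓ + u - 1)).1 (by omega)
    obtain ⟨z, hz⟩ : ∃ z, t + b + ℓ + u = z + 1 := ⟨t + b + ℓ + u - 1, by omega⟩
    rw [hz, Nat.add_sub_cancel] at h
    have h' : (ℓ + 1) * (t + b + ℓ + u) = (ℓ + 1) * (z + 1) := by rw [hz]
    nlinarith
  rw [show 2 * ℓ + 2 = b + (ℓ + 1) + (ℓ + 1 - b) by omega, Finset.sum_range_add,
    Finset.sum_range_add]
  have e1 := Finset.sum_congr rfl fun u hu =>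
    congrArg (fun n => if i = n then (1 : ℤ) else 0) (h1 u hu)
  have e2 := Finset.sum_congr rfl fun u hu =>
    congrArg (fun n => if i = n then (1 : ℤ) else 0) (h2 u hu)
  have e3 := Finset.sum_congr rfl fun u hu =>
    congrArg (fun n => if i = n then (1 : ℤ) else 0) (h3 u hu)
  rw [e1, e2, e3]
  simp only [sum_range_ite_eq_add]
  split_ifs <;> omega

lemma sum_range_mul_eq {α : Type*} [AddCommMonoid α] (f : ℕ → α) (q n : ℕ) :
    ∑ j ∈ Finset.range (q * n), f j =
      ∑ v ∈ Finset.range q, ∑ u ∈ Finset.range n, f (v + q * u) := by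
  rw [Finset.sum_comm]
  induction n with
  | zero => simp
  | succ n ih =>
    rw [mul_add, mul_one, Finset.sum_range_add, ih, Finset.sum_range_succ]
    simp only [add_comm]

end Residues

/-! ### The entries of the `δ`-vector for the two families. -/

section Apex

variable {e p ℓ m : ℕ}

lemma apexVolume_pos : 0 < apexVolume p ℓ m :=
  Nat.mul_pos (by omega) (Nat.add_one_pos _)

lemma apex_last (hp : p ≤ e) : apex p ℓ m (Fin.last e) = (apexVolume p ℓ m : ℕ) := by
  simp only [apex, apexVolume, Fin.val_last, if_neg (not_lt.2 hp), lt_irrefl, if_false]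
  push_cast
  ring

lemma apex_castSucc_of_lt (k : Fin e) (hk : (k : ℕ) < p) :
    apex p ℓ m k.castSucc = (apexVolume p ℓ m : ℕ) - 2 * (ℓ + 1) * m := by
  simp only [apex, apexVolume, Fin.val_castSucc, if_pos hk]
  push_cast
  ring

lemma apex_castSucc_of_le (k : Fin e) (hk : p ≤ (k : ℕ)) :
    apex p ℓ m k.castSucc = (apexVolume p ℓ m : ℕ) - 1 := by
  simp only [apex, apexVolume, Fin.val_castSucc, if_neg (not_lt.2 hk), k.is_lt, if_true]
  push_cast
  ring

/-- Modulo the volume, `-apex` is `2(ℓ+1)m` on the first `p` coordinates and `1` on the others. -/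
lemma toNat_emod_apex (k : Fin e) {j : ℕ} (hj : j < apexVolume p ℓ m) :
    (-(apex p ℓ m k.castSucc * j) % (apexVolume p ℓ m : ℕ)).toNat =
      if (k : ℕ) < p then 2 * (ℓ + 1) * (m * j % ((p + 1) * m + 1)) else j := by
  split_ifs with hk
  · rw [apex_castSucc_of_lt k hk]
    have h : -(((apexVolume p ℓ m : ℕ) - 2 * (ℓ + 1) * m : ℤ) * j) =
        ((2 * (ℓ + 1) * (m * j) : ℕ) : ℤ) + (apexVolume p ℓ m : ℕ) * (-j : ℤ) := by
      push_cast
      ring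
    rw [h, Int.add_mul_emod_self_left, ← Int.natCast_mod, Int.toNat_natCast, apexVolume,
      Nat.mul_mod_mul_left]
  · rw [apex_castSucc_of_le k (not_lt.1 hk)]
    have h : -(((apexVolume p ℓ m : ℕ) - 1 : ℤ) * j) =
        (j : ℤ) + (apexVolume p ℓ m : ℕ) * (-j : ℤ) := by
      ring
    rw [h, Int.add_mul_emod_self_left, ← Int.natCast_mod, Int.toNat_natCast, Nat.mod_eq_of_lt hj]

lemma boxSum_apex (he : e + 1 = 2 * ℓ + p) (hℓ : 2 ≤ ℓ) {j : ℕ} (hj : j < apexVolume p ℓ m) :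
    boxSum (apex (e := e) p ℓ m) (apexVolume p ℓ m) j =
      2 * (ℓ * j + p * (ℓ + 1) * (m * j % ((p + 1) * m + 1))) := by
  obtain ⟨s, rfl⟩ := Nat.exists_eq_add_of_le' hℓ
  -- The `2ℓ - 1` coordinates of the second kind, with the last coordinate `j` itself, give `2ℓj`.
  obtain rfl : e = p + (2 * s + 3) := by omega
  simp only [boxSum, toNat_emod_apex _ hj]
  rw [Fin.sum_univ_eq_sum_range
    (fun k => if k < p then 2 * (s + 2 + 1) * (m * j % ((p + 1) * m + 1)) else j),
    Finset.sum_range_add,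
    Finset.sum_congr rfl fun k hk => if_pos (Finset.mem_range.1 hk)]
  simp only [Nat.not_lt.2 (Nat.le_add_right p _), if_false, Finset.sum_const, Finset.card_range,
    smul_eq_mul]
  ring

lemma boxHeight_apex_le_iff (he : e + 1 = 2 * ℓ + p) (hℓ : 2 ≤ ℓ) {j : ℕ}
    (hj : j < apexVolume p ℓ m) (n : ℕ) :
    boxHeight (apex (e := e) p ℓ m) (apexVolume p ℓ m) j ≤ n ↔
      ℓ * j + p * (ℓ + 1) * (m * j % ((p + 1) * m + 1)) ≤ (ℓ + 1) * ((p + 1) * m + 1) * n := by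
  rw [boxHeight_le_iff apexVolume_pos, boxSum_apex he hℓ hj, apexVolume, mul_assoc 2, mul_assoc 2,
    Nat.mul_le_mul_left_iff two_pos]

/-- The contribution to `δ_i` of the residue class of `v` modulo `(p + 1) m + 1`. -/
def classCount (e p ℓ m i v : ℕ) : ℤ :=
  ∑ u ∈ Finset.range (2 * ℓ + 2),
    if i = boxHeight (apex (e := e) p ℓ m) (apexVolume p ℓ m) (v + ((p + 1) * m + 1) * u)
      then 1 else 0

lemma delta_apex (hpe : p ≤ e) (i : ℕ) :
    delta (hermiteSimplex (apex (e := e) p ℓ m)) i =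
      ∑ v ∈ Finset.range ((p + 1) * m + 1), classCount e p ℓ m i v := by
  rw [delta_hermiteSimplex apexVolume_pos (apex_last hpe),
    show apexVolume p ℓ m = ((p + 1) * m + 1) * (2 * ℓ + 2) by rw [apexVolume]; ring,
    sum_range_mul_eq]
  rw [show ((p + 1) * m + 1) * (2 * ℓ + 2) = apexVolume p ℓ m by rw [apexVolume]; ring]
  rfl

lemma add_mul_lt_apexVolume {u v : ℕ} (hv : v < (p + 1) * m + 1) (hu : u < 2 * ℓ + 2) :
    v + ((p + 1) * m + 1) * u < apexVolume p ℓ m := by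
  rw [apexVolume]
  nlinarith [Nat.mul_le_mul_left ((p + 1) * m + 1) (Nat.succ_le_of_lt hu)]

lemma classCount_eq (he : e + 1 = 2 * ℓ + p) (hℓ : 2 ≤ ℓ) {v t b : ℕ}
    (hv : v < (p + 1) * m + 1) (htb : t + b ≤ ℓ)
    (h : ∀ u n,
      ℓ * (v + ((p + 1) * m + 1) * u) +
          p * (ℓ + 1) * (m * (v + ((p + 1) * m + 1) * u) % ((p + 1) * m + 1)) ≤
        (ℓ + 1) * ((p + 1) * m + 1) * n ↔
      ℓ * u + (ℓ + 1) * t + b ≤ (ℓ + 1) * n) (i : ℕ) :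
    classCount e p ℓ m i v =
      (if t + 1 ≤ i ∧ i ≤ t + 2 * ℓ then 1 else 0) + (if i = t + b then 1 else 0) +
        (if i = t + b + ℓ then 1 else 0) := by
  have hH := fun u n => (ceilDiv_le_iff_le_mul (b := ℓ * u + (ℓ + 1) * t + b) (c := n)
    (Nat.add_one_pos ℓ))
  rw [← sum_height_eq (by omega) hH, classCount]
  refine Finset.sum_congr rfl fun u hu => ?_
  congr 2
  refine eq_of_forall_ge_iff fun n => ?_
  rw [boxHeight_apex_le_iff he hℓ (add_mul_lt_apexVolume hv (Finset.mem_range.1 hu)), h, hH]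

lemma classCount_zero (he : e + 1 = 2 * ℓ + p) (hℓ : 2 ≤ ℓ) (i : ℕ) :
    classCount e p ℓ m i 0 =
      (if 1 ≤ i ∧ i ≤ 2 * ℓ then 1 else 0) + (if i = 0 then 1 else 0) +
        (if i = ℓ then 1 else 0) := by
  rw [classCount_eq he hℓ (t := 0) (b := 0) (Nat.add_one_pos _) (Nat.zero_le _)]
  · simp
  · intro u n
    have hq : 0 < (p + 1) * m + 1 := Nat.add_one_pos _
    rw [zero_add, mul_left_comm m, Nat.mul_mod_right]
    rw [show ℓ * (((p + 1) * m + 1) * u) + p * (ℓ + 1) * 0 = ((p + 1) * m + 1) * (ℓ * u) by ring,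
      show (ℓ + 1) * ((p + 1) * m + 1) * n = ((p + 1) * m + 1) * ((ℓ + 1) * n) by ring,
      Nat.mul_le_mul_left_iff hq]
    simp

lemma exists_classCount_eq (he : e + 1 = 2 * ℓ + p) (hp : 1 ≤ p) (hpℓ : p ≤ ℓ) (hℓ : 2 ≤ ℓ)
    {v : ℕ} (hv : 0 < v) (hvq : v < (p + 1) * m + 1) :
    ∃ t b, 2 ≤ t + b ∧ t + b ≤ ℓ ∧ ∀ i, classCount e p ℓ m i v =
      (if t + 1 ≤ i ∧ i ≤ t + 2 * ℓ then 1 else 0) + (if i = t + b then 1 else 0) +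
        (if i = t + b + ℓ then 1 else 0) := by
  obtain ⟨t, b, h2, hle, h⟩ := exists_profile hp hpℓ hℓ hv hvq
  exact ⟨t, b, h2, hle, classCount_eq he hℓ hvq hle h⟩

/-- Extra hits lie in `{0, ℓ}` for `v = 0`, and one in `[2, ℓ]`, one in `[ℓ+2, 2ℓ]` for `v > 0`. -/
lemma classCount_bounds (he : e + 1 = 2 * ℓ + p) (hp : 1 ≤ p) (hpℓ : p ≤ ℓ) (hℓ : 2 ≤ ℓ) {v : ℕ}
    (hvq : v < (p + 1) * m + 1) :
    classCount e p ℓ m 1 v ≤ 1 ∧ 1 ≤ classCount e p ℓ m ℓ v ∧ classCount e p ℓ m (ℓ + 1) v ≤ 1 ∧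
      ∀ i, ℓ + 2 ≤ i → i ≤ 2 * ℓ → 1 ≤ classCount e p ℓ m i v := by
  rcases Nat.eq_zero_or_pos v with rfl | hv
  · refine ⟨?_, ?_, ?_, fun i _ _ => ?_⟩ <;> rw [classCount_zero he hℓ] <;> split_ifs <;>
      first | omega | contradiction
  · obtain ⟨t, b, h2, hle, h⟩ := exists_classCount_eq he hp hpℓ hℓ hv hvq
    refine ⟨?_, ?_, ?_, fun i _ _ => ?_⟩ <;> rw [h] <;> split_ifs <;> omega

lemma delta_one_le (he : e + 1 = 2 * ℓ + p) (hp : 1 ≤ p) (hpℓ : p ≤ ℓ) (hℓ : 2 ≤ ℓ) :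
    delta (hermiteSimplex (apex (e := e) p ℓ m)) 1 ≤ ((p + 1) * m + 1 : ℕ) := by
  rw [delta_apex (by omega)]
  simpa using Finset.sum_le_sum fun v hv =>
    (classCount_bounds he hp hpℓ hℓ (Finset.mem_range.1 hv)).1

lemma delta_add_one_le (he : e + 1 = 2 * ℓ + p) (hp : 1 ≤ p) (hpℓ : p ≤ ℓ) (hℓ : 2 ≤ ℓ) :
    delta (hermiteSimplex (apex (e := e) p ℓ m)) (ℓ + 1) ≤ ((p + 1) * m + 1 : ℕ) := by
  rw [delta_apex (by omega)]
  simpa using Finset.sum_le_sum fun v hv =>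
    (classCount_bounds he hp hpℓ hℓ (Finset.mem_range.1 hv)).2.2.1

lemma lt_delta_self (he : e + 1 = 2 * ℓ + p) (hp : 1 ≤ p) (hpℓ : p ≤ ℓ) (hℓ : 2 ≤ ℓ) :
    (((p + 1) * m + 1 : ℕ) : ℤ) < delta (hermiteSimplex (apex (e := e) p ℓ m)) ℓ := by
  rw [delta_apex (by omega)]
  have h := Finset.sum_lt_sum (s := Finset.range ((p + 1) * m + 1)) (f := fun _ => (1 : ℤ))
    (g := classCount e p ℓ m ℓ)
    (fun v hv => (classCount_bounds he hp hpℓ hℓ (Finset.mem_range.1 hv)).2.1)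
    ⟨0, by simp, by
      rw [classCount_zero he hℓ]
      split_ifs <;> omega⟩
  simpa using h

lemma exists_lt_delta (he : e + 1 = 2 * ℓ + p) (hp : 1 ≤ p) (hpℓ : p ≤ ℓ) (hℓ : 2 ≤ ℓ)
    (hm : 1 ≤ m) : ∃ i ∈ Finset.Icc (ℓ + 2) (2 * ℓ),
      (((p + 1) * m + 1 : ℕ) : ℤ) < delta (hermiteSimplex (apex (e := e) p ℓ m)) i := by
  have h1 : 1 < (p + 1) * m + 1 := Nat.lt_add_of_pos_left (Nat.mul_pos p.add_one_pos hm)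
  obtain ⟨t, b, h2, hle, h⟩ := exists_classCount_eq he hp hpℓ hℓ one_pos h1
  -- The second extra hit of the class `v = 1`, which exists because `m ≥ 1`.
  refine ⟨t + b + ℓ, by rw [Finset.mem_Icc]; omega, ?_⟩
  rw [delta_apex (by omega)]
  have h := Finset.sum_lt_sum (s := Finset.range ((p + 1) * m + 1)) (f := fun _ => (1 : ℤ))
    (g := classCount e p ℓ m (t + b + ℓ))
    (fun v hv => (classCount_bounds he hp hpℓ hℓ (Finset.mem_range.1 hv)).2.2.2 _
      (by omega) (by omega))
    ⟨1, Finset.mem_range.2 h1, by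
      rw [h]
      split_ifs <;> omega⟩
  simpa using h

/-! ### Interior lattice points. -/

lemma interior_residue_iff (he : e + 1 = 2 * ℓ + p) (hp : 1 ≤ p) (hpℓ : p ≤ ℓ) (hℓ : 2 ≤ ℓ)
    {j : ℕ} (hj : j < apexVolume p ℓ m) :
    (0 < j ∧ (∀ k : Fin e, ¬ ((apexVolume p ℓ m : ℕ) : ℤ) ∣ apex p ℓ m k.castSucc * j) ∧
      boxSum (apex (e := e) p ℓ m) (apexVolume p ℓ m) j < apexVolume p ℓ m) ↔
    ∃ k, 1 ≤ k ∧ k ≤ m ∧ j + p = (p + 1) * k := by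
  have hq : 0 < (p + 1) * m + 1 := Nat.add_one_pos _
  have hlt : boxSum (apex (e := e) p ℓ m) (apexVolume p ℓ m) j < apexVolume p ℓ m ↔
      ℓ * j + p * (ℓ + 1) * (m * j % ((p + 1) * m + 1)) < (ℓ + 1) * ((p + 1) * m + 1) := by
    rw [boxSum_apex he hℓ hj, apexVolume, mul_assoc 2, Nat.mul_lt_mul_left two_pos]
  rw [hlt]
  constructor
  · rintro ⟨h0, h1, h2⟩
    have hjq := Nat.mod_add_div j ((p + 1) * m + 1)
    have hmod : m * (j % ((p + 1) * m + 1)) % ((p + 1) * m + 1) =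
        m * j % ((p + 1) * m + 1) := Nat.mul_mod_mod _ _ _
    rw [← hmod] at h2
    have hv : 0 < j % ((p + 1) * m + 1) := by
      rw [Nat.pos_iff_ne_zero]
      intro hv
      -- If `q ∣ j`, the residue at the first coordinate vanishes and the point lies on the
      -- boundary.
      have hk : ((⟨0, by omega⟩ : Fin e) : ℕ) < p := hp
      refine h1 ⟨0, by omega⟩ ?_
      rw [apex_castSucc_of_lt _ hk]
      obtain ⟨z, rfl⟩ := Nat.dvd_of_mod_eq_zero hv
      refine ⟨((p + 1) * m + 1) * z - m * z, ?_⟩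
      rw [apexVolume]
      push_cast
      ring
    have hvq := Nat.mod_lt j hq
    obtain ⟨k, r, hk, hkm, hr, hvr⟩ := exists_add_eq_mul hv hvq
    obtain ⟨t, ht⟩ := Nat.exists_eq_add_of_le' hr
    have hnum := height_numerator_eq hpℓ hk hkm ht.symm hvr
    generalize j / ((p + 1) * m + 1) = u at *
    generalize j % ((p + 1) * m + 1) = v at *
    have hsum : ℓ * j + p * (ℓ + 1) * (m * v % ((p + 1) * m + 1)) =
        ((p + 1) * m + 1) * (ℓ * u) + (ℓ + 1) * ((p + 1) * m + 1) * t +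
          ((ℓ - p) * k + r * (1 + (ℓ + 1) * m)) := by
      rw [← hjq]
      linear_combination hnum
    rw [hsum] at h2
    -- A height numerator below `(ℓ+1)q` leaves no room for `t ≥ 1`, nor for `u ≥ 1` once the
    -- remainder exceeds `q`. So `r = p` and `j = (p+1)k - p`.
    have ht0 : t = 0 := by
      by_contra h
      have := Nat.mul_le_mul_left ((ℓ + 1) * ((p + 1) * m + 1)) (Nat.pos_of_ne_zero h)
      omega
    have hw := lt_remainder hp hpℓ hℓ hk hkm (by omega : r = p)
    have hu : u = 0 := by
      by_contra h
      have h3 := Nat.mul_le_mul_left ((p + 1) * m + 1)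
        (Nat.mul_le_mul_left ℓ (Nat.one_le_iff_ne_zero.2 h))
      have h4 : (ℓ + 1) * ((p + 1) * m + 1) =
        ((p + 1) * m + 1) * (ℓ * 1) + ((p + 1) * m + 1) := by ring
      omega
    subst hu
    exact ⟨k, hk, hkm, by rw [← hvr, ← hjq]; omega⟩
  · rintro ⟨k, hk, hkm, hjk⟩
    have hmod := mul_mod_add_eq hk hkm le_rfl hjk
    have hnum := height_numerator_eq hpℓ hk hkm (zero_add p) hjk
    have hle := remainder_le hpℓ hkm (zero_add p)
    have hkp : p + 1 ≤ (p + 1) * k := Nat.le_mul_of_pos_right _ hk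
    have h0 : 0 < j := by omega
    refine ⟨h0, fun i hi => ?_, ?_⟩
    · rcases Nat.lt_or_ge i p with hip | hip
      · rw [apex_castSucc_of_lt i hip, sub_mul, dvd_sub_right (Dvd.intro _ rfl), apexVolume] at hi
        have hi' : 2 * (ℓ + 1) * ((p + 1) * m + 1) ∣ 2 * (ℓ + 1) * (m * j) := by
          rw [← mul_assoc]
          exact_mod_cast hi
        have h3 := Nat.mod_eq_zero_of_dvd (Nat.dvd_of_mul_dvd_mul_left (by omega) hi')
        rw [h3, add_mul, one_mul] at hmod
        omega
      · rw [apex_castSucc_of_le i hip, sub_mul, dvd_sub_right (Dvd.intro _ rfl), one_mul] at hi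
        exact absurd (Nat.le_of_dvd h0 (Int.natCast_dvd_natCast.1 hi)) (not_le.2 hj)
    · rw [hnum]
      rw [Nat.sub_zero] at hle
      nlinarith

lemma interiorLatticeCount_apex (he : e + 1 = 2 * ℓ + p) (hp : 1 ≤ p) (hpℓ : p ≤ ℓ)
    (hℓ : 2 ≤ ℓ) : interiorLatticeCount (hermiteSimplex (apex (e := e) p ℓ m)) = m := by
  rw [interiorLatticeCount_hermiteSimplex apexVolume_pos (apex_last (by omega))]
  have himg : ((Finset.range (apexVolume p ℓ m)).filter fun j : ℕ => 0 < j ∧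
      (∀ k : Fin e, ¬ ((apexVolume p ℓ m : ℕ) : ℤ) ∣ apex p ℓ m k.castSucc * j) ∧
      boxSum (apex (e := e) p ℓ m) (apexVolume p ℓ m) j < apexVolume p ℓ m) =
      (Finset.Icc 1 m).image fun k => (p + 1) * k - p := by
    ext j
    rw [Finset.mem_filter, Finset.mem_range,
      and_congr_right fun hj => interior_residue_iff he hp hpℓ hℓ hj]
    simp only [Finset.mem_image, Finset.mem_Icc]
    constructor
    · rintro ⟨_, k, hk, hkm, hjk⟩
      exact ⟨k, ⟨hk, hkm⟩, by omega⟩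
    · rintro ⟨k, ⟨hk, hkm⟩, rfl⟩
      have h1 : p + 1 ≤ (p + 1) * k := Nat.le_mul_of_pos_right _ hk
      have h2 : (p + 1) * k ≤ (p + 1) * m := Nat.mul_le_mul_left _ hkm
      refine ⟨?_, k, hk, hkm, by omega⟩
      have h3 : (p + 1) * m + 1 ≤ apexVolume p ℓ m := Nat.le_mul_of_pos_left _ (by omega)
      omega
  rw [himg, Finset.card_image_of_injOn, Nat.card_Icc, Nat.add_sub_cancel]
  intro k hk k' hk' h
  simp only [Finset.coe_Icc, Set.mem_Icc] at hk hk'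
  have h1 : p + 1 ≤ (p + 1) * k := Nat.le_mul_of_pos_right _ hk.1
  have h2 : p + 1 ≤ (p + 1) * k' := Nat.le_mul_of_pos_right _ hk'.1
  exact Nat.eq_of_mul_eq_mul_left p.add_one_pos (by simp only at h; omega)

/-! ### Non-unimodality from a valley, and assembly. -/

lemma not_isUnimodalSeq {d i j k : ℕ} {α : Type*} [Preorder α] {f : ℕ → α} (hij : i ≤ j)
    (hjk : j ≤ k) (hk : k ≤ d) (h1 : f j < f i) (h2 : f j < f k) : ¬ IsUnimodalSeq d f := by
  rintro ⟨c, _, hup, hdown⟩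
  rcases Nat.lt_or_ge j c with hjc | hcj
  · have hmono : ∀ n, i ≤ n → n ≤ c → f i ≤ f n := fun n hn =>
      Nat.le_induction (fun _ => le_rfl)
        (fun l _ ih hl => (ih (by omega)).trans (hup l (by omega))) n hn
    exact h1.not_ge (hmono j hij hjc.le)
  · have hanti : ∀ n, j ≤ n → n ≤ d → f n ≤ f j := fun n hn =>
      Nat.le_induction (fun _ => le_rfl)
        (fun l hl ih hld => (hdown l (by omega) (by omega)).trans (ih (by omega))) n hn
    exact h2.not_ge (hanti k hjk hk)

theorem isNonUnimodalSimplex_apex (he : e + 1 = 2 * ℓ + p) (hp : 1 ≤ p) (hpℓ : p ≤ ℓ)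
    (hℓ : 2 ≤ ℓ) (hm : 1 ≤ m) :
    IsNonUnimodalSimplex (e + 1) m (hermiteSimplex (apex (e := e) p ℓ m)) ∧
      delta (hermiteSimplex (apex (e := e) p ℓ m)) 1 <
        delta (hermiteSimplex (apex (e := e) p ℓ m)) ℓ ∧
      delta (hermiteSimplex (apex (e := e) p ℓ m)) (ℓ + 1) <
        delta (hermiteSimplex (apex (e := e) p ℓ m)) ℓ ∧
      delta (hermiteSimplex (apex (e := e) p ℓ m)) (ℓ + 1) <
        (Finset.Icc (ℓ + 2) (2 * ℓ)).sup' (Finset.nonempty_Icc.2 (by omega))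
          (delta (hermiteSimplex (apex (e := e) p ℓ m))) := by
  have hlast : apex p ℓ m (Fin.last e) = (apexVolume p ℓ m : ℕ) := apex_last (by omega)
  have hne : apex p ℓ m (Fin.last e) ≠ 0 := by
    rw [hlast]
    exact_mod_cast apexVolume_pos.ne'
  have h1 := delta_one_le (m := m) he hp hpℓ hℓ
  have h2 := delta_add_one_le (m := m) he hp hpℓ hℓ
  have h3 := lt_delta_self (m := m) he hp hpℓ hℓ
  obtain ⟨i, hi, h4⟩ := exists_lt_delta he hp hpℓ hℓ hm
  refine ⟨⟨isLatticeSimplex_hermiteSimplex hne, polytopeDim_hermiteSimplex hne,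
    interiorLatticeCount_apex he hp hpℓ hℓ,
    deltaSeries_hermiteSimplex_eq_sum_delta apexVolume_pos hlast, ?_⟩,
    h1.trans_lt h3, h2.trans_lt h3, (Finset.lt_sup'_iff _).2 ⟨i, hi, h2.trans_lt h4⟩⟩
  rw [Finset.mem_Icc] at hi
  exact not_isUnimodalSeq (i := ℓ) (j := ℓ + 1) (k := i) (by omega) (by omega) (by omega)
    (h2.trans_lt h3) (h2.trans_lt h4)

end Apex

theorem mainTheorem3 :
    (∀ d m : ℕ, 5 ≤ d → 1 ≤ m → ∃ P : Set (Fin d → ℝ), IsNonUnimodalSimplex d m P) ∧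
    (∀ (ℓ m : ℕ) (hℓ : 2 ≤ ℓ), 1 ≤ m →
      IsNonUnimodalSimplex (2 * ℓ + 1) m (polytopeOdd ℓ m) ∧
      delta (polytopeOdd ℓ m) 1 < delta (polytopeOdd ℓ m) ℓ ∧
      delta (polytopeOdd ℓ m) (ℓ + 1) < delta (polytopeOdd ℓ m) ℓ ∧
      delta (polytopeOdd ℓ m) (ℓ + 1) <
        (Finset.Icc (ℓ + 2) (2 * ℓ)).sup' (Finset.nonempty_Icc.2 (by omega))
          (delta (polytopeOdd ℓ m))) ∧
    (∀ (ℓ m : ℕ) (hℓ : 2 ≤ ℓ), 1 ≤ m →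
      IsNonUnimodalSimplex (2 * ℓ + 2) m (polytopeEven ℓ m) ∧
      delta (polytopeEven ℓ m) 1 < delta (polytopeEven ℓ m) ℓ ∧
      delta (polytopeEven ℓ m) (ℓ + 1) < delta (polytopeEven ℓ m) ℓ ∧
      delta (polytopeEven ℓ m) (ℓ + 1) <
        (Finset.Icc (ℓ + 2) (2 * ℓ)).sup' (Finset.nonempty_Icc.2 (by omega))
          (delta (polytopeEven ℓ m))) := by
  refine ⟨fun d m hd hm => ?_, fun ℓ m hℓ hm => ?_, fun ℓ m hℓ hm => ?_⟩
  · rcases Nat.even_or_odd' d with ⟨n, rfl | rfl⟩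
    -- For even `d = 2n` take `ℓ = n - 1`; `d ≥ 5` forces `n ≥ 3`, hence `ℓ ≥ 2 = p`.
    · obtain ⟨ℓ, rfl⟩ := Nat.exists_eq_add_of_le' (show 1 ≤ n by omega)
      exact ⟨_, (isNonUnimodalSimplex_apex (e := 2 * ℓ + 1) (p := 2) (ℓ := ℓ) (by omega)
        (by omega) (by omega) (by omega) hm).1⟩
    · exact ⟨_, (isNonUnimodalSimplex_apex (e := 2 * n) (p := 1) (ℓ := n) (by omega)
        (by omega) (by omega) (by omega) hm).1⟩
  · rw [polytopeOdd_eq]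
    exact isNonUnimodalSimplex_apex (by omega) (by omega) (by omega) hℓ hm
  · rw [polytopeEven_eq]
    exact isNonUnimodalSimplex_apex (by omega) (by omega) (by omega) hℓ hm
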